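/- Let $q$ be a prime power, $[i] := q^i$, and let $\mathbf g=(g_1,\dots,g_n)\in\mathbb F_{q^m}^n$ have $\mathbb F_q$-linearly independent entries (so $n\le m$). For $k\le n$ let $\mathcal G$ be the Gabidulin code of length $n$, dimension $k$ and minimum rank distance $d=n-k+1$ generated by $\mathbf g,\mathbf g^{[1]},\dots,\mathbf g^{[k-1]}$ (entrywise powers). Let $\mathbf C\in\mathbb F_{q^m}^{\ell\times n}$ be a codeword of the $\ell$-interleaved Gabidulin code (every row of $\mathbf C$ lies in $\mathcal G$), and let $\mathbf E\in\mathbb F_{q^m}^{\ell\times n}$ be an error matrix with $\operatorname{rank}_{\mathbb F_q}(\mathbf E)=t\le d-2$ such that $t\le\ell$ (high-order condition) and $\operatorname{rank}_{\mathbb F_{q^m}}(\mathbf E)=t$ (full-rank condition). Here $\operatorname{rank}_{\mathbb F_q}(\mathbf E)$ is the rank of the $\ell m\times n$ matrix over $\mathbb F_q$ obtained by expanding every entry of $\mathbf E$ in a basis of $\mathbb F_{q^m}$ over $\mathbb F_q$. Then each of the following three decoders, applied to the received word $\mathbf R=\mathbf C+\mathbf E$ (with $t$ unknown), succeeds and returns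 exactly $\mathbf C$, whatever choices it makes in its steps. Put $t_{\max}:=\lfloor \ell(n-k)/(\ell+1)\rfloor$. A decoder fails if an object that it asks for does not exist. 1. *Loidreau–Overbeck decoder.* Take the largest $\tau\le t_{\max}$ for which the matrix with the rows $\mathbf g,\mathbf g^{[1]},\dots,\mathbf g^{[n-\tau-2]}$ and the rows of $\mathbf R,\mathbf R^{[1]},\dots,\mathbf R^{[n-k-\tau-1]}$ has $\mathbb F_{q^m}$-rank $n-1$; take a nonzero $\mathbf h$ in its right kernel and an invertible $\mathbf T\in\mathbb F_q^{n\times n}$ such that the first $\tau$ entries of $\mathbf T\mathbf h^\top$ are zero; return a codeword $\mathbf C'$ of the interleaved code such that the last $n-\tau$ columns of $(\mathbf R-\mathbf C')\mathbf T^{-1}$ are zero. 2. *Sidorenko–Bossert decoder* (variant for vertically interleaved codes). Take $\mathbf h\in\mathbb F_{q^m}^n$ with $\mathbb F_q$-linearly independent entries such that $\mathbf h,\dots,\mathbf h^{[n-k-1]}$ are the rows of a parity-check matrix of $\mathcal G$; compute the syndromes $s^{(i)}_j=\sum_l R_{i,l}h_l^{[j]}$ and the modified syndromes $\tilde s^{(i)}_j=\big(s^{(i)}_{n-k-1-j}\big)^{[j-(n-k-1)]}$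 for $0\le j<n-k$ (negative exponents denote powers of the inverse of $x\mapsto x^q$). Let $L$ be the least length for which there are $\Gamma_0=1,\Gamma_1,\dots,\Gamma_L\in\mathbb F_{q^m}$ with $\sum_{j=0}^{L}\Gamma_j\,(\tilde s^{(i)}_{r-j})^{[j]}=0$ for all $i$ and all $L\le r<n-k$; fail if $L>t_{\max}$ or if the $\Gamma_j$ are not unique. Take an $\mathbb F_q$-basis $d_1,\dots,d_L$ of the space of roots in $\mathbb F_{q^m}$ of $\sum_j\Gamma_jx^{[j]}$ (fail if this space does not have dimension $L$), a matrix $\mathbf B\in\mathbb F_q^{L\times n}$ with $d_u=\sum_l B_{u,l}h_l$, and $\mathbf A\in\mathbb F_{q^m}^{\ell\times L}$ with $\sum_u A_{i,u}d_u^{[j]}=s^{(i)}_j$ for all $i$ and all $0\le j<n-k$; return $\mathbf R-\mathbf A\mathbf B$. 3. *Wachter-Zeh–Zeh decoder.* With $\tau=t_{\max}$, take a basis of the $\mathbb F_{q^m}$-space of all tuples $(Q_0,\dots,Q_\ell)$ of linearized polynomials with $\deg_qQ_0<n-\tau$ and $\deg_qQ_i<n-\tau-(k-1)$ for $1\le i\le\ell$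 such that $Q_0(g_j)+\sum_{i=1}^{\ell}Q_i(R_{i,j})=0$ for all $j$; find the linearized polynomials $f_1,\dots,f_\ell$ of $q$-degree less than $k$ with $Q_0(x)+\sum_{i=1}^{\ell}Q_i(f_i(x))=0$ for every tuple of the basis (fail if there is no solution or more than one); return the matrix $\big(f_i(g_j)\big)_{i,j}$. -/

import Mathlib

open Polynomial

noncomputable section

namespace RankMetric

/-! Throughout, `F` is the finite field with `q = Fintype.card F` elements and `K` is an extension
of `F` of finite degree `m = Module.finrank F K`, so that `K` has `q ^ m` elements. -/

section Ranks

variable (F : Type*) {K : Type*} [Field F] [Field K] [Algebra F K] [FiniteDimensional F K]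

/-- The expansion of a matrix over `K` to a matrix over `F`: each row is replaced by the `m` rows
of coordinates of its entries with respect to a basis of `K` over `F`. -/
def ext {ι κ : Type*} (A : Matrix ι κ K) : Matrix (ι × Fin (Module.finrank F K)) κ F :=
  Matrix.of fun p j => (Module.finBasis F K).repr (A p.1 j) p.2

/-- The `F`-rank of a matrix over `K`: the rank of its expansion over `F`. -/
def smallRank {ι κ : Type*} [Fintype κ] (A : Matrix ι κ K) : ℕ :=
  (ext F A).rank

/-- The `F`-rank of a row vector over `K`. -/
def vecRank {κ : Type*} [Fintype κ] (a : κ → K) : ℕ :=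
  smallRank F (Matrix.replicateRow Unit a)

end Ranks

section Codes

variable (F : Type*) {K : Type*} [Field F] [Fintype F] [Field K] [Algebra F K]

/-- The `s × n` Moore matrix with rows `g, g^[1], …, g^[s-1]`, where `[i] = q ^ i`. -/
def moore {n : ℕ} (s : ℕ) (g : Fin n → K) : Matrix (Fin s) (Fin n) K :=
  Matrix.of fun i j => g j ^ Fintype.card F ^ (i : ℕ)

/-- The code generated by the `k × n` Moore matrix of `g`. It is the Gabidulin code of length `n`
and dimension `k` if `g` has `F`-rank `n` and `k ≤ n`. -/
def gabidulin {n : ℕ} (g : Fin n → K) (k : ℕ) : Submodule K (Fin n → K) :=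
  Submodule.span K (Set.range fun i : Fin k => moore F k g i)

/-- The homogeneous `ℓ`-interleaved code with constituent code `𝒞`: all `ℓ × n` matrices whose rows
are codewords of `𝒞`. -/
def interleaved {n : ℕ} (ℓ : ℕ) (𝒞 : Submodule K (Fin n → K)) : Set (Matrix (Fin ℓ) (Fin n) K) :=
  {C | ∀ i, C i ∈ 𝒞}

/-- The linearized polynomial `∑ i, p i * X ^ [i]`, of `q`-degree less than `s`. -/
def linPoly {s : ℕ} (p : Fin s → K) : K[X] :=
  ∑ i, C (p i) * X ^ Fintype.card F ^ (i : ℕ)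

end Codes

/-- The decoding radius `⌊ℓ (n - k) / (ℓ + 1)⌋` of the decoders below. -/
def radius (ℓ n k : ℕ) : ℕ := ℓ * (n - k) / (ℓ + 1)

/-- A nondeterministic procedure is given by the set of its possible results, where `none` is a
decoding failure. `attempt S next` chooses an arbitrary element `a` of `S` and continues with
`next a`; if `S` is empty, it reports a decoding failure. -/
def attempt {α β : Type*} (S : Set α) (next : α → Set (Option β)) : Set (Option β) :=
  {out | (∃ a ∈ S, out ∈ next a) ∨ (S = ∅ ∧ out = none)}

section LoidreauOverbeck

variable (F : Type*) {K : Type*} [Field F] [Fintype F] [Field K] [Algebra F K]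

/-- The matrix with rows `g, g^[1], …, g^[n-τ-2]` and the rows of `R, R^[1], …, R^[n-k-τ-1]`. -/
def loMatrix {ℓ n : ℕ} (g : Fin n → K) (k τ : ℕ) (R : Matrix (Fin ℓ) (Fin n) K) :
    Matrix (Fin (n - τ - 1) ⊕ Fin (n - k - τ) × Fin ℓ) (Fin n) K :=
  Matrix.fromRows (moore F (n - τ - 1) g)
    (Matrix.of fun p j => R p.2 j ^ Fintype.card F ^ (p.1 : ℕ))

/-- The Loidreau–Overbeck decoder.
1. Starting from the decoding radius, decrease `τ` until the matrix above has rank `n - 1`.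
2. Find a nonzero vector `h` in its right kernel.
3. Find an invertible matrix `T` over `F` for which the first `τ` entries of `T hᵀ` are zero.
4. Find the interleaved codeword that agrees with the received word in the last `n - τ` columns
   after multiplication by `T⁻¹` from the right. -/
def loidreauOverbeck {ℓ n : ℕ} (g : Fin n → K) (k : ℕ) (R : Matrix (Fin ℓ) (Fin n) K) :
    Set (Option (Matrix (Fin ℓ) (Fin n) K)) :=
  attempt {τ : ℕ | IsGreatest {τ : ℕ | τ ≤ radius ℓ n k ∧ (loMatrix F g k τ R).rank = n - 1} τ}
    fun τ =>
  attempt {h : Fin n → K | h ≠ 0 ∧ (loMatrix F g k τ R).mulVec h = 0} fun h =>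
  attempt {T : Matrix (Fin n) (Fin n) F | IsUnit T.det ∧
      ∀ j : Fin n, (j : ℕ) < τ → (T.map (algebraMap F K)).mulVec h j = 0} fun T =>
  attempt {C : Matrix (Fin ℓ) (Fin n) K | C ∈ interleaved ℓ (gabidulin F g k) ∧
      ∀ i, ∀ j : Fin n, τ ≤ (j : ℕ) → ((R - C) * (T.map (algebraMap F K))⁻¹) i j = 0} fun C =>
  {some C}

end LoidreauOverbeck

section SidorenkoBossert

variable (F : Type*) {K : Type*} [Field F] [Fintype F] [Field K] [Algebra F K]
  [FiniteDimensional F K]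

/-- The Moore matrix of `h` with `n - k` rows is a parity-check matrix of the Gabidulin code of
dimension `k` that is given by `g`. -/
def IsParityCheckVector {n : ℕ} (g : Fin n → K) (k : ℕ) (h : Fin n → K) : Prop :=
  vecRank F h = n ∧ moore F (n - k) h * (moore F k g).transpose = 0

/-- The syndromes `s_j = ∑ l, R_{i,l} h_l^[j]` of the `i`-th row of the received word. -/
def syndrome {ℓ n : ℕ} (h : Fin n → K) (R : Matrix (Fin ℓ) (Fin n) K) (i : Fin ℓ) (j : ℕ) : K :=
  ∑ l, R i l * h l ^ Fintype.card F ^ j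

/-- The modified syndromes `s_{N-1-j}^[j-(N-1)]`, `0 ≤ j < N`; the exponent is an iterated inverse
of the Frobenius automorphism `x ↦ x ^ q`. -/
def modSyndrome {ℓ n : ℕ} (h : Fin n → K) (N : ℕ) (R : Matrix (Fin ℓ) (Fin n) K) (i : Fin ℓ)
    (j : ℕ) : K :=
  ((FiniteField.frobeniusAlgEquivOfAlgebraic F K).symm ^ (N - 1 - j))
    (syndrome F h R i (N - 1 - j))

/-- The linearized shift register of length `L` with connection polynomial `∑ j, Γ_j X^[j]`, where
`Γ_0 = 1`, generates all sequences `s_i` of length `N`. -/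
def Generates {ℓ : ℕ} (N : ℕ) (s : Fin ℓ → ℕ → K) (L : ℕ) (Γ : Fin (L + 1) → K) : Prop :=
  Γ 0 = 1 ∧ ∀ i, ∀ r, L ≤ r → r < N →
    ∑ j : Fin (L + 1), Γ j * s i (r - (j : ℕ)) ^ Fintype.card F ^ (j : ℕ) = 0

/-- The Sidorenko–Bossert syndrome decoder, in the variant for vertically interleaved codes, where
the constituent errors have a common row space.
1. Take a parity-check matrix of the constituent code in Moore form, given by `h`.
2. Find the length `L` of the shortest linearized shift registers that generate the `ℓ` sequences
   of modified syndromes; it has to be at most the decoding radius.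
3. Find the connection polynomial `Γ` (the row error span polynomial); it has to be unique.
4. Find a basis `d_1, …, d_L` over `F` of the space of roots of `Γ` in `K`.
5. Find a matrix `B` over `F` with `d_u = ∑ l, B_{u,l} h_l`.
6. Find a matrix `A` over `K` such that `A B` has the syndromes of the received word.
7. Subtract the error `A B` from the received word. -/
def sidorenkoBossert {ℓ n : ℕ} (g : Fin n → K) (k : ℕ) (R : Matrix (Fin ℓ) (Fin n) K) :
    Set (Option (Matrix (Fin ℓ) (Fin n) K)) :=
  attempt {h : Fin n → K | IsParityCheckVector F g k h} fun h =>
  attempt {L : ℕ | L ≤ radius ℓ n k ∧ IsLeast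
      {L : ℕ | ∃ Γ, Generates F (n - k) (modSyndrome F h (n - k) R) L Γ} L} fun L =>
  attempt {Γ : Fin (L + 1) → K | ∀ Γ',
      Generates F (n - k) (modSyndrome F h (n - k) R) L Γ' ↔ Γ' = Γ} fun Γ =>
  attempt {d : Fin L → K | LinearIndependent F d ∧
      ∀ x : K, x ∈ Submodule.span F (Set.range d) ↔ (linPoly F Γ).IsRoot x} fun d =>
  attempt {B : Matrix (Fin L) (Fin n) F | ∀ u, d u = ∑ l, B u l • h l} fun B =>
  attempt {A : Matrix (Fin ℓ) (Fin L) K | ∀ i, ∀ j < n - k,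
      ∑ u, A i u * d u ^ Fintype.card F ^ j = syndrome F h R i j} fun A =>
  {some (R - A * B.map (algebraMap F K))}

end SidorenkoBossert

section WachterZehZeh

variable (F : Type*) {K : Type*} [Field F] [Fintype F] [Field K]

/-- The space of multivariate linearized polynomials `Q_0(x) + Q_1(y_1) + … + Q_ℓ(y_ℓ)`, where
`Q_0` has `q`-degree less than `n - τ` and `Q_1, …, Q_ℓ` have `q`-degree less than
`n - τ - (k - 1)`, that vanish at all points `(g_j, R_{1,j}, …, R_{ℓ,j})`. -/
def interpolationSpace {ℓ n : ℕ} (g : Fin n → K) (k τ : ℕ) (R : Matrix (Fin ℓ) (Fin n) K) :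
    Submodule K ((Fin (n - τ) → K) × (Fin ℓ → Fin (n - τ + 1 - k) → K)) where
  carrier := {Q | ∀ j, (linPoly F Q.1).eval (g j) + ∑ i, (linPoly F (Q.2 i)).eval (R i j) = 0}
  zero_mem' := by
    intro j
    simp [linPoly]
  add_mem' := by
    intro P Q hP hQ j
    have h := congrArg₂ (· + ·) (hP j) (hQ j)
    simp only [linPoly, eval_finsetSum, eval_mul, eval_C, eval_pow, eval_X, Prod.fst_add,
      Prod.snd_add, Pi.add_apply, add_mul, Finset.sum_add_distrib, add_zero] at h ⊢
    rw [← h]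
    ring
  smul_mem' := by
    intro a Q hQ j
    have h := congrArg (a * ·) (hQ j)
    simpa [linPoly, eval_finsetSum, mul_add, Finset.mul_sum, mul_assoc] using h

/-- The interpolation-based unique decoder of Wachter-Zeh and Zeh.
1. Interpolation: with `τ` the decoding radius, find a basis of the space of interpolation
   polynomials.
2. Root finding: find the linearized polynomials `f_1, …, f_ℓ` of `q`-degree less than `k` with
   `Q_0(x) + Q_1(f_1(x)) + … + Q_ℓ(f_ℓ(x)) = 0` for all `Q` in this basis; the solution of this
   linear system has to be unique.
3. Evaluate `f_1, …, f_ℓ` at the entries of `g`. -/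
def wachterZehZeh {ℓ n : ℕ} (g : Fin n → K) (k : ℕ) (R : Matrix (Fin ℓ) (Fin n) K) :
    Set (Option (Matrix (Fin ℓ) (Fin n) K)) :=
  let I := interpolationSpace F g k (radius ℓ n k) R
  attempt (Set.univ : Set (Module.Basis (Fin (Module.finrank K I)) K I)) fun b =>
  attempt {f : Fin ℓ → Fin k → K | ∀ f' : Fin ℓ → Fin k → K,
      (∀ v, linPoly F (b v).1.1 + ∑ i, (linPoly F ((b v).1.2 i)).comp (linPoly F (f' i)) = 0) ↔
        f' = f} fun f =>
  {some (Matrix.of fun i j => (linPoly F (f i)).eval (g j))}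

end WachterZehZeh

end RankMetric

end

/-! Write B for t rows of an invertible matrix T over F that span the row space of the expanded
error. Then E = A B, and since E also has K-rank t, the ℓ × t matrix A has a left inverse A'
(`exists_factorization`). Applying an automorphism of K to A keeps it left invertible and fixes B.
Together with the bound on roots of linearized polynomials (`linPoly_coeff_eq_zero`), this drives
all three decoders. The condition t ≤ ℓ serves only to put t within the decoding radius.

Loidreau–Overbeck: the rows of the matrix lie in the span of n - τ - 1 Moore rows and the t rows of
B, and A' recovers B from R - C, so the two spans agree. The rank is n - 1 at τ = t and smaller
above it. A kernel vector h has exactly the row space of B as its F-linear relations, so any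
admissible T moves the error into the first t columns; the other n - t ≥ k columns determine the
codeword.

Sidorenko–Bossert: with d = B h, the shift register equations are the values Γ(d_u) multiplied by a
Frobenius twist of A. Cancelling A leaves Γ(d_u) = 0 for all u. Hence the shortest length is t, Γ is
unique with root space the span of d, and the choices of d, B and A amount to a change of basis that
leaves A B unchanged.

Wachter-Zeh–Zeh: every interpolation tuple annihilates the true message polynomials, because the
substituted polynomial has too many roots at the error-free points of g T⁻¹. Conversely, for any a
there is a tuple with Q_i = a_i x + b_i x^q, where b is chosen to cancel the error; comparing
coefficients from the lowest upwards leaves only one solution. -/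

namespace RankMetric

/-! ### Moore matrices and roots of linearized polynomials -/

section Moore

variable (F : Type*) {K : Type*} [Field F] [Fintype F] [Field K] [Algebra F K]

/-- The `s`-th power of the Frobenius endomorphism `x ↦ x ^ q` of an `F`-algebra. -/
noncomputable def frob {R : Type*} [CommRing R] [Algebra F R] (s : ℕ) : R →ₐ[F] R :=
  FiniteField.frobeniusAlgHom F R ^ s

theorem frob_apply {R : Type*} [CommRing R] [Algebra F R] (s : ℕ) (x : R) :
    frob F s x = x ^ Fintype.card F ^ s := by
  simp only [frob, AlgHom.coe_pow, FiniteField.coe_frobeniusAlgHom, pow_iterate]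

theorem sum_pow_card {R ι : Type*} [CommRing R] [Algebra F R] (I : Finset ι) (f : ι → R) (s : ℕ) :
    (∑ i ∈ I, f i) ^ Fintype.card F ^ s = ∑ i ∈ I, f i ^ Fintype.card F ^ s := by
  simp only [← frob_apply, map_sum]

theorem sum_smul_pow_card {R ι : Type*} [CommRing R] [Algebra F R] (I : Finset ι) (a : ι → F)
    (f : ι → R) (s : ℕ) :
    (∑ i ∈ I, a i • f i) ^ Fintype.card F ^ s = ∑ i ∈ I, a i • f i ^ Fintype.card F ^ s := by
  simp only [← frob_apply, map_sum, map_smul]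

theorem eval_linPoly {s : ℕ} (p : Fin s → K) (x : K) :
    (linPoly F p).eval x = ∑ i, p i * x ^ Fintype.card F ^ (i : ℕ) := by
  simp [linPoly, eval_finsetSum]

/-- Evaluation of a linearized polynomial, as a linear map. -/
noncomputable def linEval {s : ℕ} (p : Fin s → K) : K →ₗ[F] K :=
  ∑ i, LinearMap.mulLeft F (p i) ∘ₗ (frob F (i : ℕ)).toLinearMap

theorem linEval_apply {s : ℕ} (p : Fin s → K) (x : K) :
    linEval F p x = (linPoly F p).eval x := by
  simp [linEval, eval_linPoly, frob_apply]

theorem card_pow_injective : Function.Injective fun i : ℕ => Fintype.card F ^ i :=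
  Nat.pow_right_injective Fintype.one_lt_card

theorem coeff_linPoly {s : ℕ} (p : Fin s → K) (j : Fin s) :
    (linPoly F p).coeff (Fintype.card F ^ (j : ℕ)) = p j := by
  rw [linPoly, finsetSum_coeff, Finset.sum_eq_single j]
  · simp
  · intro i _ hij
    rw [coeff_C_mul_X_pow, if_neg]
    exact fun h => hij (Fin.ext (card_pow_injective F h).symm)
  · simp

theorem linPoly_injective {s : ℕ} : Function.Injective (linPoly F : (Fin s → K) → K[X]) :=
  fun p p' h => funext fun j => by rw [← coeff_linPoly F p j, h, coeff_linPoly]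

theorem natDegree_linPoly_lt {s : ℕ} (p : Fin s → K) :
    (linPoly F p).natDegree < Fintype.card F ^ s := by
  refine Nat.lt_of_le_pred (pow_pos Fintype.card_pos _) ?_
  refine natDegree_sum_le_of_forall_le _ _ fun i _ => (natDegree_C_mul_X_pow_le _ _).trans ?_
  exact Nat.le_pred_of_lt (Nat.pow_lt_pow_right Fintype.one_lt_card i.2)

variable [FiniteDimensional F K]

/-- A linearized polynomial of `q`-degree less than `s` that has at least `s` linearly independent
roots is zero. -/
theorem linPoly_coeff_eq_zero {ι : Type*} [Fintype ι] {x : ι → K} (hx : LinearIndependent F x)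
    {s : ℕ} (hs : s ≤ Fintype.card ι) (p : Fin s → K)
    (h : ∀ u, ∑ i, p i * x u ^ Fintype.card F ^ (i : ℕ) = 0) : p = 0 := by
  classical
  have : Finite K := Module.finite_of_finite F
  -- By F-linearity, the whole span of the points consists of roots, and its size exceeds the
  -- degree.
  let W := Submodule.span F (Set.range x)
  have : Fintype W := Fintype.ofFinite W
  have hW : Fintype.card W = Fintype.card F ^ Fintype.card ι := by
    rw [Module.card_eq_pow_finrank (K := F), finrank_span_eq_card hx]
  have hle : W ≤ LinearMap.ker (linEval F p) := by
    rw [Submodule.span_le]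
    rintro _ ⟨u, rfl⟩
    simpa [linEval_apply, eval_linPoly] using h u
  have h0 : linPoly F p = 0 := by
    refine eq_zero_of_natDegree_lt_card_of_eval_eq_zero _
      (f := fun w : W => (w : K)) Subtype.val_injective (fun w => ?_) ?_
    · rw [← linEval_apply]
      exact hle w.2
    · rw [hW]
      exact (natDegree_linPoly_lt F p).trans_le (Nat.pow_le_pow_right Fintype.card_pos hs)
  apply linPoly_injective F
  rw [h0]
  simp [linPoly]

theorem det_moore_ne_zero {r : ℕ} {x : Fin r → K} (hx : LinearIndependent F x) :
    (moore F r x).det ≠ 0 := by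
  intro h
  obtain ⟨v, hv, hv0⟩ := Matrix.exists_vecMul_eq_zero_iff.2 h
  refine hv (linPoly_coeff_eq_zero F hx (by simp) v fun u => ?_)
  simpa [Matrix.vecMul, dotProduct, moore] using congrFun hv0 u

/-- The first `Fintype.card ι` equations already form a nonsingular square Moore system. -/
theorem eq_zero_of_moore_mulVec {ι : Type*} [Fintype ι] {N : ℕ} {x : ι → K}
    (hx : LinearIndependent F x) (hN : Fintype.card ι ≤ N) (y : ι → K)
    (h : ∀ s < N, ∑ u, y u * x u ^ Fintype.card F ^ s = 0) : y = 0 := by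
  let e := Fintype.equivFin ι
  have hx' : LinearIndependent F (x ∘ e.symm) := hx.comp _ e.symm.injective
  by_contra hy
  refine det_moore_ne_zero F hx' (Matrix.exists_mulVec_eq_zero_iff.1
    ⟨y ∘ e.symm, fun h0 => hy (funext fun u => ?_), funext fun s => ?_⟩)
  · simpa using congrFun h0 (e u)
  · rw [Pi.zero_apply, ← h s (s.2.trans_le hN), ← e.symm.sum_comp]
    simp [Matrix.mulVec, dotProduct, moore, mul_comm]

theorem exists_moore_interpolation {r : ℕ} {x : Fin r → K} (hx : LinearIndependent F x)
    (b : Fin r → K) : ∃ c : Fin r → K, ∀ u, ∑ i, c i * x u ^ Fintype.card F ^ (i : ℕ) = b u := by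
  refine ⟨Matrix.vecMul b (moore F r x)⁻¹, fun u => ?_⟩
  have h : Matrix.vecMul (Matrix.vecMul b (moore F r x)⁻¹) (moore F r x) = b := by
    rw [Matrix.vecMul_vecMul, Matrix.nonsing_inv_mul _ (det_moore_ne_zero F hx).isUnit,
      Matrix.vecMul_one]
  simpa [Matrix.vecMul, dotProduct, moore] using congrFun h u

end Moore

/-! ### Ranks over F and K, and the factorization of the error -/

section Ranks

variable (F : Type*) {K : Type*} [Field F] [Field K] [Algebra F K]

theorem linearIndependent_mul {n : ℕ} {g : Fin n → K} (hg : LinearIndependent F g)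
    {S : Matrix (Fin n) (Fin n) F} (hS : IsUnit S.det) :
    LinearIndependent F fun j => ∑ l, S l j • g l := by
  rw [Fintype.linearIndependent_iff] at hg ⊢
  intro a ha
  have h : S.mulVec a = 0 := by
    ext l
    refine hg (S.mulVec a) ?_ l
    rw [← ha]
    simp only [Matrix.mulVec, dotProduct, Finset.sum_smul, Finset.smul_sum, smul_smul]
    rw [Finset.sum_comm]
    simp only [mul_comm]
  have := Matrix.eq_zero_of_mulVec_eq_zero hS.ne_zero h
  exact fun i => congrFun this i

/-- Every subspace of `F ^ n` is spanned by the first rows of an invertible matrix. -/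
theorem exists_adapted_matrix {n t : ℕ} (W : Submodule F (Fin n → F))
    (hW : Module.finrank F W = t) :
    ∃ T : Matrix (Fin n) (Fin n) F, IsUnit T.det ∧
      ∀ v, v ∈ W ↔ ∀ j : Fin n, t ≤ j → Matrix.vecMul v T⁻¹ j = 0 := by
  obtain ⟨W', hc⟩ := W.exists_isCompl
  have hsum := Submodule.finrank_add_eq_of_isCompl hc
  rw [hW, Module.finrank_fin_fun] at hsum
  have hW' : Module.finrank F W' = n - t := by omega
  let e : Fin t ⊕ Fin (n - t) ≃ Fin n := finSumFinEquiv.trans (finCongr (by omega))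
  -- The rows of `T` are a basis of `W` followed by one of a complement, so v T⁻¹ lists the
  -- coordinates of v and membership in `W` means that the complement coordinates vanish.
  let b₀ := ((Module.finBasisOfFinrankEq F W hW).prod (Module.finBasisOfFinrankEq F W' hW')).map
    (Submodule.prodEquivOfIsCompl W W' hc)
  let b := b₀.reindex e
  let T : Matrix (Fin n) (Fin n) F := Matrix.of fun i => b i
  have hT : ∀ v, Matrix.vecMul (b.repr v) T = v := fun v => by
    conv_rhs => rw [← b.sum_repr v]
    ext j
    simp [Matrix.vecMul, dotProduct, T]
  have hu : IsUnit T.det := by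
    rw [isUnit_iff_ne_zero]
    intro h0
    obtain ⟨w, hw, hw0⟩ := Matrix.exists_vecMul_eq_zero_iff.2 h0
    obtain ⟨v, hv⟩ := b.equivFun.surjective w
    have : Matrix.vecMul (b.equivFun v) T = v := hT v
    rw [hv, hw0] at this
    rw [← this, map_zero] at hv
    exact hw hv.symm
  refine ⟨T, hu, fun v => ?_⟩
  have hrepr : Matrix.vecMul v T⁻¹ = b.repr v := by
    conv_lhs => rw [← hT v]
    rw [Matrix.vecMul_vecMul, Matrix.mul_nonsing_inv _ hu, Matrix.vecMul_one]
  have hval : ∀ j, b.repr v (e (Sum.inr j)) = (Module.finBasisOfFinrankEq F W' hW').repr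
      ((Submodule.prodEquivOfIsCompl W W' hc).symm v).2 j := fun j => by
    simp [b, b₀]
  rw [hrepr, ← Submodule.prodEquivOfIsCompl_symm_apply_snd_eq_zero (p := W) (q := W') hc,
    ← (Module.finBasisOfFinrankEq F W' hW').repr.map_eq_zero_iff]
  constructor
  · intro h j hj
    obtain ⟨i | i, rfl⟩ := e.surjective j
    · exact absurd hj (by simp [e])
    · rw [hval, h]
      rfl
  · intro h
    ext j
    rw [← hval]
    exact h _ (by simp [e])

/-- The first `t` rows of the adapted matrix lie in the subspace. -/
theorem adapted_row_mem {n t : ℕ} {W : Submodule F (Fin n → F)} {T : Matrix (Fin n) (Fin n) F}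
    (hT : IsUnit T.det) (h : ∀ v, v ∈ W ↔ ∀ j : Fin n, t ≤ j → Matrix.vecMul v T⁻¹ j = 0)
    (i : Fin n) (hi : (i : ℕ) < t) : T i ∈ W := by
  rw [h]
  intro j hj
  have : Matrix.vecMul (T i) T⁻¹ = (T * T⁻¹) i := by
    rw [Matrix.mul_apply_eq_vecMul]
  rw [this, Matrix.mul_nonsing_inv _ hT, Matrix.one_apply_ne]
  rintro rfl
  omega

variable [FiniteDimensional F K]

theorem linearIndependent_of_vecRank {n : ℕ} {g : Fin n → K} (hg : vecRank F g = n) :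
    LinearIndependent F g := by
  rw [vecRank, smallRank, Matrix.rank_eq_finrank_span_cols] at hg
  have h : LinearIndependent F (ext F (Matrix.replicateRow Unit g)).col := by
    rw [linearIndependent_iff_card_eq_finrank_span, Set.finrank, hg, Fintype.card_fin]
  let φ : K →ₗ[F] (Unit × Fin (Module.finrank F K) → F) :=
    LinearMap.pi fun p => LinearMap.proj p.2 ∘ₗ (Module.finBasis F K).equivFun.toLinearMap
  refine LinearIndependent.of_comp φ ?_
  exact h

theorem vecRank_of_linearIndependent {n : ℕ} {g : Fin n → K} (hg : LinearIndependent F g) :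
    vecRank F g = n := by
  let φ : K →ₗ[F] (Unit × Fin (Module.finrank F K) → F) :=
    LinearMap.pi fun p => LinearMap.proj p.2 ∘ₗ (Module.finBasis F K).equivFun.toLinearMap
  have hφ : LinearMap.ker φ = ⊥ := by
    refine LinearMap.ker_eq_bot'.2 fun x hx => ?_
    apply (Module.finBasis F K).equivFun.map_eq_zero_iff.1
    ext j
    exact congrFun hx ((), j)
  have h := (hg.map' φ hφ)
  rw [vecRank, smallRank, Matrix.rank_eq_finrank_span_cols]
  have := finrank_span_eq_card h
  rw [Fintype.card_fin] at this
  exact this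

/-- A matrix of `F`-rank `t` and `K`-rank `t` factors through an invertible matrix over `F`. -/
theorem exists_factorization {ℓ n t : ℕ} (E : Matrix (Fin ℓ) (Fin n) K)
    (hsmall : smallRank F E = t) (hfull : E.rank = t) :
    ∃ (T : Matrix (Fin n) (Fin n) F) (ht : t ≤ n) (A : Matrix (Fin ℓ) (Fin t) K)
      (A' : Matrix (Fin t) (Fin ℓ) K), IsUnit T.det ∧ A' * A = 1 ∧
      E = A * (T.submatrix (Fin.castLE ht) id).map (algebraMap F K) := by
  have ht : t ≤ n := by
    rw [← hfull]
    simpa using E.rank_le_width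
  rw [smallRank, Matrix.rank_eq_finrank_span_row] at hsmall
  obtain ⟨T, hT, hW⟩ := exists_adapted_matrix F _ hsmall
  let T' := T.map (algebraMap F K)
  let S' := T⁻¹.map (algebraMap F K)
  have hST : S' * T' = 1 := by
    rw [← Matrix.map_mul, Matrix.nonsing_inv_mul _ hT]
    simp
  have h0 : ∀ i, ∀ j : Fin n, t ≤ j → (E * S') i j = 0 := by
    intro i j hj
    apply (Module.finBasis F K).equivFun.map_eq_zero_iff.1
    ext s
    have := (hW (ext F E (i, s))).1 (Submodule.subset_span ⟨(i, s), rfl⟩) j hj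
    refine Eq.trans ?_ this
    have hsum : (E * S') i j = ∑ l, T⁻¹ l j • E i l := by
      rw [Matrix.mul_apply]
      refine Finset.sum_congr rfl fun l _ => ?_
      rw [Algebra.smul_def, mul_comm]
      rfl
    rw [hsum, map_sum, Finset.sum_apply]
    refine Finset.sum_congr rfl fun l _ => ?_
    rw [map_smul, Pi.smul_apply, smul_eq_mul, mul_comm]
    rfl
  let A : Matrix (Fin ℓ) (Fin t) K := Matrix.of fun i u => (E * S') i (Fin.castLE ht u)
  have hE : E = A * (T.submatrix (Fin.castLE ht) id).map (algebraMap F K) := by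
    calc E = E * S' * T' := by rw [Matrix.mul_assoc, hST, Matrix.mul_one]
      _ = _ := by
        ext i j
        rw [Matrix.mul_apply, Matrix.mul_apply]
        symm
        refine Finset.sum_of_injOn (Fin.castLE ht) (Fin.castLE_injective ht).injOn (by simp) ?_ ?_
        · intro l _ hl
          rw [h0, zero_mul]
          by_contra hlt
          exact hl ⟨⟨l, by omega⟩, by simp, rfl⟩
        · intro u _
          rfl
  -- The full-rank condition enters here: t = rank E ≤ rank A, so the columns of `A` are independent
  -- and a left inverse exists.
  have hA : A.rank = t := by
    refine le_antisymm (by simpa using A.rank_le_width) ?_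
    refine hfull.symm.trans_le ((congrArg Matrix.rank hE).trans_le ?_)
    exact Matrix.rank_mul_le_left _ _
  have hAi : LinearIndependent K A.col := by
    rw [linearIndependent_iff_card_eq_finrank_span, Set.finrank,
      ← Matrix.rank_eq_finrank_span_cols, hA, Fintype.card_fin]
  obtain ⟨f, hf⟩ := A.mulVecLin.exists_leftInverse_of_injective
    (LinearMap.ker_eq_bot.2 (Matrix.mulVec_injective_iff.2 hAi))
  refine ⟨T, ht, A, LinearMap.toMatrix' f, hT, ?_, hE⟩
  have := congrArg LinearMap.toMatrix' hf
  rwa [LinearMap.toMatrix'_comp, ← Matrix.toLin'_apply', LinearMap.toMatrix'_toLin',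
    LinearMap.toMatrix'_id] at this

end Ranks

end RankMetric

/-! ### Tools shared by the decoders -/

namespace RankMetric

/-- Splits each decoder step into its two obligations: some choice exists, and every choice leads to
the same output. -/
theorem attempt_eq_singleton {α β : Type*} {S : Set α} {next : α → Set (Option β)} {c : β}
    (hS : S.Nonempty) (h : ∀ a ∈ S, next a = {some c}) : attempt S next = {some c} := by
  ext out
  constructor
  · rintro (⟨a, ha, ho⟩ | ⟨h0, _⟩)
    · rwa [h a ha] at ho
    · exact absurd h0 hS.ne_empty
  · intro ho
    obtain ⟨a, ha⟩ := hS
    exact Or.inl ⟨a, ha, by rwa [h a ha]⟩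

theorem le_radius {ℓ n k t : ℕ} (hl : t ≤ ℓ) (ht : t + 1 ≤ n - k) : t ≤ radius ℓ n k := by
  rw [radius, Nat.le_div_iff_mul_le (Nat.succ_pos _)]
  calc t * (ℓ + 1) = ℓ * t + t := by ring
    _ ≤ ℓ * t + ℓ := by omega
    _ = ℓ * (t + 1) := by ring
    _ ≤ ℓ * (n - k) := Nat.mul_le_mul_left _ ht

theorem radius_lt {ℓ n k : ℕ} (h : 0 < n - k) : radius ℓ n k < n - k := by
  rw [radius, Nat.div_lt_iff_lt_mul (Nat.succ_pos _)]
  nlinarith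

section Factorization

variable (F : Type*) {K : Type*} [Field F] [Field K] [Algebra F K]

theorem factorization_apply {ℓ n t : ℕ} {T : Matrix (Fin n) (Fin n) F} (ht : t ≤ n)
    (A : Matrix (Fin ℓ) (Fin t) K) (i : Fin ℓ) (j : Fin n) :
    (A * (T.submatrix (Fin.castLE ht) id).map (algebraMap F K)) i j =
      ∑ u, T (Fin.castLE ht u) j • A i u := by
  rw [Matrix.mul_apply]
  refine Finset.sum_congr rfl fun u _ => ?_
  rw [Algebra.smul_def, mul_comm]
  rfl

/-- The first t rows of T, multiplied by T⁻¹, are the first t unit vectors, so the later columns of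
E T⁻¹ are free of error. -/
theorem factorization_smul_inv {ℓ n t : ℕ} {T : Matrix (Fin n) (Fin n) F} (hT : IsUnit T.det)
    (ht : t ≤ n) (A : Matrix (Fin ℓ) (Fin t) K) (i : Fin ℓ) (j : Fin n) (hj : t ≤ (j : ℕ)) :
    ∑ l, T⁻¹ l j •
      (A * (T.submatrix (Fin.castLE ht) id).map (algebraMap F K)) i l = 0 := by
  simp only [factorization_apply, Finset.smul_sum, smul_smul]
  rw [Finset.sum_comm]
  refine Finset.sum_eq_zero fun u _ => ?_
  rw [← Finset.sum_smul]
  have h := congrFun (congrFun (Matrix.mul_nonsing_inv T hT) (Fin.castLE ht u)) j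
  rw [Matrix.mul_apply, Matrix.one_apply_ne (fun h => by
    have := u.2
    rw [← h, Fin.val_castLE] at hj
    omega)] at h
  simp only [mul_comm] at h ⊢
  rw [h, zero_smul]

end Factorization

section LeftInverse

variable {ι κ K : Type*} [Fintype ι] [Fintype κ] [DecidableEq κ] [Field K] {A : Matrix ι κ K}
  {A' : Matrix κ ι K}

/-- Applying `φ` to A' A = 1 shows that the twisted matrix is still left invertible; `φ` will be the
Frobenius map. -/
theorem exists_sum_mul_map_eq (hA : A' * A = 1) (φ : K →+* K) (c : κ → K) :
    ∃ b : ι → K, ∀ u, ∑ i, b i * φ (A i u) = c u := by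
  refine ⟨Matrix.vecMul c (A'.map φ), fun u => ?_⟩
  have h : Matrix.vecMul (Matrix.vecMul c (A'.map φ)) (A.map φ) = c := by
    rw [Matrix.vecMul_vecMul, ← Matrix.map_mul, hA, Matrix.map_one φ φ.map_zero φ.map_one,
      Matrix.vecMul_one]
  exact congrFun h u

theorem eq_zero_of_sum_map_mul_eq_zero (hA : A' * A = 1) (φ : K →+* K) {y : κ → K}
    (hy : ∀ i, ∑ u, φ (A i u) * y u = 0) : y = 0 := by
  have h : (A.map φ).mulVec y = 0 := funext hy
  have h' := congrArg (A'.map φ).mulVec h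
  rwa [Matrix.mulVec_mulVec, ← Matrix.map_mul, hA, Matrix.map_one φ φ.map_zero φ.map_one,
    Matrix.one_mulVec, Matrix.mulVec_zero] at h'

end LeftInverse

theorem card_fin_ge (n t : ℕ) : Fintype.card {j : Fin n // t ≤ (j : ℕ)} = n - t := by
  have h := Fintype.card_subtype_compl fun j : Fin n => (j : ℕ) < t
  simp only [not_lt, Fintype.card_fin] at h
  rw [h, Fintype.card_subtype, Fin.card_filter_val_lt]
  omega

/-! ### Composition of linearized polynomials and the Wachter-Zeh–Zeh decoder -/

variable (F : Type*) {K : Type*} [Field F] [Fintype F] [Field K] [Algebra F K]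

theorem exists_coeff_of_mem_gabidulin {n k : ℕ} {g c : Fin n → K} (hc : c ∈ gabidulin F g k) :
    ∃ f : Fin k → K, ∀ j, c j = (linPoly F f).eval (g j) := by
  obtain ⟨f, hf⟩ := (Submodule.mem_span_range_iff_exists_fun K).1 hc
  refine ⟨f, fun j => ?_⟩
  rw [← hf, eval_linPoly]
  simp [moore]

/-- The space of linearized polynomials of `q`-degree less than `s`, as a linear map. -/
noncomputable def linPolyHom (s : ℕ) : (Fin s → K) →ₗ[K] K[X] where
  toFun := linPoly F
  map_add' p p' := by simp [linPoly, add_mul, Finset.sum_add_distrib]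
  map_smul' a p := by simp [linPoly, Finset.smul_sum, smul_eq_C_mul, mul_assoc]

theorem linPoly_comp {s k : ℕ} (p : Fin s → K) (f : Fin k → K) :
    (linPoly F p).comp (linPoly F f) = ∑ i, ∑ j, C (p i * f j ^ Fintype.card F ^ (i : ℕ)) *
      X ^ Fintype.card F ^ ((i : ℕ) + j) := by
  rw [linPoly, Polynomial.sum_comp]
  refine Finset.sum_congr rfl fun i _ => ?_
  rw [mul_comp, C_comp, X_pow_comp, linPoly, sum_pow_card, Finset.mul_sum]
  refine Finset.sum_congr rfl fun j _ => ?_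
  rw [mul_pow, ← C_pow, ← pow_mul, ← pow_add, ← mul_assoc, ← C_mul, add_comm]

/-- Under composition q-degrees add: (s - 1) + (k - 1) ≤ N - 1. -/
theorem exists_linPoly_eq_comp {s k N : ℕ} (h : s + k ≤ N + 1) (p : Fin s → K) (f : Fin k → K) :
    ∃ c : Fin N → K, linPoly F c = (linPoly F p).comp (linPoly F f) := by
  have : (linPoly F p).comp (linPoly F f) ∈ LinearMap.range (linPolyHom F (K := K) N) := by
    rw [linPoly_comp]
    refine sum_mem fun i _ => sum_mem fun j _ => ?_
    refine ⟨Pi.single ⟨i + j, by omega⟩ (p i * f j ^ Fintype.card F ^ (i : ℕ)), ?_⟩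
    change linPoly F _ = _
    rw [linPoly, Finset.sum_eq_single ⟨i + j, by omega⟩]
    · simp
    · intro m _ hm
      rw [Pi.single_eq_of_ne hm, C_0, zero_mul]
    · simp
  exact this

/-- Substitution of `f_1, …, f_ℓ` into a multivariate linearized polynomial. -/
noncomputable def substHom {N s ℓ k : ℕ} (f : Fin ℓ → Fin k → K) :
    ((Fin N → K) × (Fin ℓ → Fin s → K)) →ₗ[K] K[X] where
  toFun Q := linPoly F Q.1 + ∑ i, (linPoly F (Q.2 i)).comp (linPoly F (f i))
  map_add' P Q := by
    have h (s : ℕ) (p p' : Fin s → K) : linPoly F (p + p') = linPoly F p + linPoly F p' :=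
      (linPolyHom F s).map_add p p'
    simp only [Prod.fst_add, Prod.snd_add, Pi.add_apply, h, add_comp, Finset.sum_add_distrib]
    ring
  map_smul' a Q := by
    have h (s : ℕ) (p : Fin s → K) : linPoly F (a • p) = a • linPoly F p :=
      (linPolyHom F s).map_smul a p
    simp only [Prod.smul_fst, Prod.smul_snd, Pi.smul_apply, h, smul_comp, ← Finset.smul_sum,
      RingHom.id_apply, smul_add]

theorem substHom_apply {N s ℓ k : ℕ} (f : Fin ℓ → Fin k → K)
    (Q : (Fin N → K) × (Fin ℓ → Fin s → K)) :
    substHom F f Q = linPoly F Q.1 + ∑ i, (linPoly F (Q.2 i)).comp (linPoly F (f i)) := rfl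

theorem exists_linPoly_eq_substHom {N s ℓ k : ℕ} (h : s + k ≤ N + 1) (f : Fin ℓ → Fin k → K)
    (Q : (Fin N → K) × (Fin ℓ → Fin s → K)) : ∃ c : Fin N → K, linPoly F c = substHom F f Q := by
  choose c hc using fun i => exists_linPoly_eq_comp F h (Q.2 i) (f i)
  refine ⟨Q.1 + ∑ i, c i, ?_⟩
  rw [substHom_apply]
  simp only [← hc]
  change linPolyHom F N _ = linPolyHom F N _ + ∑ i, linPolyHom F N _
  rw [map_add, map_sum]

/-- For a x + b x^q the coefficient involves only p_j and p_{j-1}, which makes an induction on j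
possible. The last sum encodes p_{j-1}^q, read as 0 for j = 0. -/
theorem coeff_comp_pair {D k : ℕ} (hD : 2 ≤ D) (a b : K) (p : Fin k → K) (j : Fin k) :
    ((linPoly F (fun m : Fin D => if (m : ℕ) = 0 then a else if (m : ℕ) = 1 then b else 0)).comp
      (linPoly F p)).coeff (Fintype.card F ^ (j : ℕ)) =
      a * p j + b * ∑ m : Fin k, if (j : ℕ) = m + 1 then p m ^ Fintype.card F else 0 := by
  obtain ⟨D, rfl⟩ := Nat.exists_eq_add_of_le' hD
  rw [linPoly_comp, Fin.sum_univ_succ, Fin.sum_univ_succ]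
  simp only [Fin.val_zero, Fin.val_succ, coeff_add, finsetSum_coeff, coeff_C_mul_X_pow,
    (card_pow_injective F).eq_iff]
  rw [Finset.sum_eq_single j, Finset.mul_sum]
  · simp [add_comm 1]
  · simp +contextual [Fin.ext_iff, eq_comm]
  · simp

theorem eval_linPoly_pair {D : ℕ} (hD : 2 ≤ D) (a b x : K) :
    (linPoly F (fun m : Fin D => if (m : ℕ) = 0 then a else if (m : ℕ) = 1 then b else 0)).eval x =
      a * x + b * x ^ Fintype.card F := by
  obtain ⟨D, rfl⟩ := Nat.exists_eq_add_of_le' hD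
  rw [eval_linPoly, Fin.sum_univ_succ, Fin.sum_univ_succ]
  simp

variable [FiniteDimensional F K]

/-- Every interpolation polynomial vanishes at the message polynomials. -/
theorem substHom_eq_zero {ℓ n k t τ : ℕ} {g : Fin n → K} (hg : LinearIndependent F g)
    {T : Matrix (Fin n) (Fin n) F} (hT : IsUnit T.det) (htn : t ≤ n)
    (A : Matrix (Fin ℓ) (Fin t) K) (f : Fin ℓ → Fin k → K) {R : Matrix (Fin ℓ) (Fin n) K}
    (hR : ∀ i j, R i j = (linPoly F (f i)).eval (g j) +
      (A * (T.submatrix (Fin.castLE htn) id).map (algebraMap F K)) i j)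
    (htτ : t ≤ τ) (hτ : τ < n - k) {Q : (Fin (n - τ) → K) × (Fin ℓ → Fin (n - τ + 1 - k) → K)}
    (hQ : Q ∈ interpolationSpace F g k τ R) : substHom F f Q = 0 := by
  obtain ⟨c, hc⟩ := exists_linPoly_eq_substHom F (by omega) f Q
  set E := A * (T.submatrix (Fin.castLE htn) id).map (algebraMap F K) with hE
  have hval : ∀ l, (linPoly F c).eval (g l) = - ∑ i, linEval F (Q.2 i) (E i l) := by
    intro l
    have h := hQ l
    simp only [hR, ← linEval_apply, map_add, Finset.sum_add_distrib] at h
    rw [hc, substHom_apply, eval_add, eval_finsetSum]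
    simp only [eval_comp, ← linEval_apply]
    linear_combination h
  have hc0 : c = 0 := by
    -- At these n - t ≥ n - τ independent points of g T⁻¹ the error contributes nothing.
    let S := {j : Fin n // t ≤ (j : ℕ)}
    have hx := (linearIndependent_mul F hg (Matrix.isUnit_nonsing_inv_det _ hT)).comp
      (Subtype.val : S → Fin n) Subtype.val_injective
    refine linPoly_coeff_eq_zero F hx ?_ c fun j => ?_
    · exact (Nat.sub_le_sub_left htτ n).trans_eq (card_fin_ge n t).symm
    · rw [← eval_linPoly, ← linEval_apply, Function.comp_apply, map_sum]
      simp only [map_smul]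
      simp only [linEval_apply F c, hval, smul_neg, Finset.sum_neg_distrib,
        Finset.smul_sum]
      rw [Finset.sum_comm, neg_eq_zero]
      refine Finset.sum_eq_zero fun i _ => ?_
      simp only [← map_smul, ← map_sum]
      rw [factorization_smul_inv F hT htn A i j j.2, map_zero]
  rw [← hc, hc0]
  exact (linPolyHom F _).map_zero

theorem wachterZehZeh_eq {ℓ n k t : ℕ} {g : Fin n → K} (hg : LinearIndependent F g)
    {T : Matrix (Fin n) (Fin n) F} (hT : IsUnit T.det) (htn : t ≤ n)
    {A : Matrix (Fin ℓ) (Fin t) K} {A' : Matrix (Fin t) (Fin ℓ) K} (hA : A' * A = 1)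
    {C : Matrix (Fin ℓ) (Fin n) K} (hC : C ∈ interleaved ℓ (gabidulin F g k))
    (ht : t + 1 ≤ n - k) (horder : t ≤ ℓ) :
    wachterZehZeh F g k (C + A * (T.submatrix (Fin.castLE htn) id).map (algebraMap F K)) =
      {some C} := by
  set E := A * (T.submatrix (Fin.castLE htn) id).map (algebraMap F K) with hE
  choose f hf using fun i => exists_coeff_of_mem_gabidulin F (hC i)
  have htτ := le_radius (ℓ := ℓ) horder ht
  have hτ : radius ℓ n k < n - k := radius_lt (by omega)
  have hR : ∀ i j, (C + E) i j = (linPoly F (f i)).eval (g j) + E i j := fun i j => by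
    rw [Matrix.add_apply, hf]
  have hroot : ∀ Q ∈ interpolationSpace F g k (radius ℓ n k) (C + E), substHom F f Q = 0 :=
    fun Q hQ => substHom_eq_zero F hg hT htn A f hR htτ hτ hQ
  have huniq : ∀ f' : Fin ℓ → Fin k → K,
      (∀ Q ∈ interpolationSpace F g k (radius ℓ n k) (C + E), substHom F f' Q = 0) → f' = f := by
    intro f' hf'
    have key : ∀ j, ∀ hj : j < k, ∀ i, f' i ⟨j, hj⟩ = f i ⟨j, hj⟩ := by
      intro j
      induction j using Nat.strong_induction_on with
      | _ j ih =>
      intro hj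
      suffices h : ∀ a : Fin ℓ → K, ∑ i, a i * (f' i ⟨j, hj⟩ - f i ⟨j, hj⟩) = 0 by
        intro i
        have := h (Pi.single i 1)
        rw [Finset.sum_eq_single i (by simp +contextual [Pi.single_eq_of_ne]) (by simp)] at this
        simpa [sub_eq_zero] using this
      intro a
      -- `b` makes ∑ (a_i x + b_i x^q) vanish on every column of A, hence, by F-linearity, on every
      -- column of E.
      obtain ⟨b, hb⟩ := exists_sum_mul_map_eq hA
        (FiniteField.frobeniusAlgHom F K : K →+* K) fun u => -∑ i, a i * A i u
      -- The radius is below n - k, so the degree bound leaves room for the x^q term.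
      have hD : 2 ≤ n - radius ℓ n k + 1 - k := by omega
      let Q' : Fin ℓ → Fin (n - radius ℓ n k + 1 - k) → K := fun i m =>
        if (m : ℕ) = 0 then a i else if (m : ℕ) = 1 then b i else 0
      obtain ⟨c, hc⟩ := exists_linPoly_eq_substHom F (N := n - radius ℓ n k) (by omega) f (0, Q')
      have hlin0 : linPoly F (0 : Fin (n - radius ℓ n k) → K) = 0 := (linPolyHom F _).map_zero
      have hneg : linPoly F (-c) = -linPoly F c := (linPolyHom F _).map_neg c
      rw [substHom_apply, hlin0, zero_add] at hc
      have hmem : (-c, Q') ∈ interpolationSpace F g k (radius ℓ n k) (C + E) := by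
        intro l
        have hQA : ∀ u, ∑ i, linEval F (Q' i) (A i u) = 0 := by
          intro u
          simp only [linEval_apply, Q', eval_linPoly_pair F hD, Finset.sum_add_distrib]
          have := hb u
          simp only [RingHom.coe_coe, FiniteField.coe_frobeniusAlgHom] at this
          rw [this, add_neg_cancel]
        have hQE : ∑ i, linEval F (Q' i) (E i l) = 0 := by
          simp only [hE, factorization_apply, map_sum, map_smul]
          rw [Finset.sum_comm]
          simp only [← Finset.smul_sum, hQA, smul_zero, Finset.sum_const_zero]
        simp only [hR, ← linEval_apply F (Q' _), map_add, Finset.sum_add_distrib, hQE, hneg, hc,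
          eval_neg, eval_finsetSum, eval_comp]
        simp only [linEval_apply, add_zero, neg_add_cancel]
      have h := hf' _ hmem
      rw [substHom_apply] at h
      simp only [hneg, hc, neg_add_eq_zero] at h
      have h := congrArg (fun P => P.coeff (Fintype.card F ^ j)) h
      simp only [finsetSum_coeff] at h
      have hco := fun i (p : Fin k → K) => coeff_comp_pair F hD (a i) (b i) p ⟨j, hj⟩
      simp only [Q', hco, Finset.sum_add_distrib] at h
      -- The x^q terms contribute only coefficients of index j - 1, which agree by induction.
      have hlow : ∀ i, (∑ m : Fin k, if j = m + 1 then f' i m ^ Fintype.card F else 0) =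
          ∑ m : Fin k, if j = m + 1 then f i m ^ Fintype.card F else 0 := by
        intro i
        refine Finset.sum_congr rfl fun m _ => ?_
        split_ifs with hm
        · rw [show f' i m = f i m from ih m (by omega) m.2 i]
        · rfl
      simp only [hlow, add_left_inj] at h
      simp only [mul_sub, Finset.sum_sub_distrib, h, sub_self]
    exact funext fun i => funext fun j => key j j.2 i
  have hbasis : ∀ (b : Module.Basis
      (Fin (Module.finrank K (interpolationSpace F g k (radius ℓ n k) (C + E)))) K
      (interpolationSpace F g k (radius ℓ n k) (C + E))) (f' : Fin ℓ → Fin k → K),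
      (∀ v, substHom F f' (b v).1 = 0) → f' = f := by
    intro b f' h
    have h0 : substHom F f' ∘ₗ (interpolationSpace F g k (radius ℓ n k) (C + E)).subtype = 0 :=
      b.ext h
    exact huniq f' fun Q hQ => LinearMap.congr_fun h0 ⟨Q, hQ⟩
  refine attempt_eq_singleton ⟨Module.finBasis K _, trivial⟩ fun b _ => ?_
  refine attempt_eq_singleton ⟨f, fun f' => ⟨hbasis b f', ?_⟩⟩ fun f' h => ?_
  · rintro rfl v
    exact hroot _ (b v).2
  · obtain rfl : f' = f := hbasis b f' ((h f').2 rfl)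
    simp only [← hf]
    rfl

end RankMetric

namespace RankMetric

/-! ### Relation spaces, dual codes and the Sidorenko–Bossert decoder -/

section Relations

variable (F : Type*) {K : Type*} [Field F] [Field K] [Algebra F K]

/-- The space of linear relations over `F` between the entries of a vector. -/
noncomputable def relations {n : ℕ} (h : Fin n → K) : Submodule F (Fin n → F) :=
  LinearMap.ker (Fintype.linearCombination F h)

theorem mem_relations {n : ℕ} {h : Fin n → K} {v : Fin n → F} :
    v ∈ relations F h ↔ ∑ l, v l • h l = 0 := by
  rw [relations, LinearMap.mem_ker, Fintype.linearCombination_apply]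

theorem linearIndependent_of_relations {n : ℕ} {h : Fin n → K}
    (h0 : Module.finrank F (relations F h) = 0) : LinearIndependent F h := by
  rw [Submodule.finrank_eq_zero] at h0
  rw [Fintype.linearIndependent_iff]
  intro a ha
  have : a ∈ relations F h := (mem_relations F).2 ha
  rw [h0, Submodule.mem_bot] at this
  exact fun i => congrFun this i

end Relations

variable (F : Type*) {K : Type*} [Field F] [Fintype F] [Field K] [Algebra F K]
  [FiniteDimensional F K]

/-- A nonzero vector that is orthogonal to the first `N` rows of a Moore matrix has `F`-rank
greater than `N`. -/
theorem finrank_relations_add_lt {n N : ℕ} {g h : Fin n → K} (hg : LinearIndependent F g)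
    (hh : h ≠ 0) (horth : ∀ s < N, ∑ l, h l * g l ^ Fintype.card F ^ s = 0) :
    Module.finrank F (relations F h) + N < n := by
  by_contra! hle
  -- With y = T h and x = g T⁻¹ the pairing is unchanged, but the first `w` entries of y vanish. At
  -- most N unknowns then face N Moore equations.
  obtain ⟨T, hT, hW⟩ := exists_adapted_matrix F (relations F h) rfl
  set w := Module.finrank F (relations F h)
  let y : Fin n → K := fun i => ∑ l, T i l • h l
  have hy : ∀ i : Fin n, (i : ℕ) < w → y i = 0 := fun i hi =>
    (mem_relations F).1 (adapted_row_mem F hT hW i hi)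
  have hhy : ∀ l, h l = ∑ i, T⁻¹ l i • y i := by
    intro l
    simp only [y, Finset.smul_sum, smul_smul]
    rw [Finset.sum_comm]
    simp only [← Finset.sum_smul, ← Matrix.mul_apply, Matrix.nonsing_inv_mul _ hT,
      Matrix.one_apply, ite_smul, one_smul, zero_smul]
    simp
  let x : Fin n → K := fun i => ∑ l, T⁻¹ l i • g l
  have hx : LinearIndependent F x :=
    linearIndependent_mul F hg (Matrix.isUnit_nonsing_inv_det _ hT)
  let S := {j : Fin n // w ≤ (j : ℕ)}
  have hS : (y ∘ (Subtype.val : S → Fin n)) = 0 := by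
    refine eq_zero_of_moore_mulVec F (hx.comp (Subtype.val : S → Fin n) Subtype.val_injective)
      (N := N) ?_ _ fun s hs => ?_
    · rw [card_fin_ge]
      omega
    · refine (Fintype.sum_of_injective (Subtype.val : S → Fin n) Subtype.val_injective
        _ (fun i => y i * x i ^ Fintype.card F ^ s) ?_ fun i => rfl).trans ?_
      rotate_left
      · rw [← horth s hs]
        simp only [x, sum_smul_pow_card, hhy, Finset.mul_sum, Finset.sum_mul, smul_mul_assoc,
          mul_smul_comm]
        rw [Finset.sum_comm]
      · intro i hi
        rw [hy i (by
          by_contra hlt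
          exact hi ⟨⟨i, not_lt.1 hlt⟩, rfl⟩), zero_mul]
  apply hh
  ext l
  rw [hhy]
  refine Finset.sum_eq_zero fun i _ => ?_
  rcases lt_or_ge (i : ℕ) w with hi | hi
  · rw [hy i hi, smul_zero]
  · rw [show y i = 0 from congrFun hS ⟨i, hi⟩, smul_zero]

/-- The inverse of the `s`-th power of the Frobenius automorphism. -/
noncomputable def invFrob (s : ℕ) : Gal(K/F) :=
  (FiniteField.frobeniusAlgEquivOfAlgebraic F K).symm ^ s

theorem invFrob_pow_card (s : ℕ) (x : K) : invFrob F s x ^ Fintype.card F ^ s = x := by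
  have h : ∀ y : K, (FiniteField.frobeniusAlgEquivOfAlgebraic F K ^ s) y =
      y ^ Fintype.card F ^ s := fun y => by
    rw [AlgEquiv.coe_pow, FiniteField.coe_frobeniusAlgEquivOfAlgebraic_iterate]
  rw [← h, invFrob, ← AlgEquiv.mul_apply]
  have : FiniteField.frobeniusAlgEquivOfAlgebraic F K ^ s *
      (FiniteField.frobeniusAlgEquivOfAlgebraic F K).symm ^ s = 1 := by
    change _ ^ s * (FiniteField.frobeniusAlgEquivOfAlgebraic F K)⁻¹ ^ s = 1
    rw [inv_pow, mul_inv_cancel]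
  rw [this, AlgEquiv.one_apply]

theorem invFrob_add_pow_card (a b : ℕ) (x : K) :
    invFrob F (a + b) x ^ Fintype.card F ^ b = invFrob F a x := by
  rw [add_comm, invFrob, pow_add, AlgEquiv.mul_apply]
  exact invFrob_pow_card F b _

/-- The dual of a Gabidulin code is a Gabidulin code. -/
theorem exists_isParityCheckVector {n k : ℕ} {g : Fin n → K} (hg : LinearIndependent F g)
    (hk : 0 < n - k) : ∃ h, IsParityCheckVector F g k h := by
  -- The pairing of h^[j] with g^[i] is a Frobenius power of that of h with g^[i-j]. Here i - j runs
  -- through the n - 1 values from -(n-k-1) to k - 1; the twist makes them start at 0.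
  let g' : Fin n → K := fun l => invFrob F (n - k - 1) (g l)
  have hg' : LinearIndependent F g' :=
    hg.map' (invFrob F (n - k - 1)).toLinearMap
      (LinearMap.ker_eq_bot.2 (invFrob F (n - k - 1)).injective)
  have hker := LinearMap.ker_ne_bot_of_finrank_lt (f := (moore F (n - 1) g').mulVecLin) (by
    simp only [Module.finrank_fin_fun]
    omega)
  obtain ⟨h, hh, hh0⟩ := Submodule.exists_mem_ne_zero_of_ne_bot hker
  have horth : ∀ s < n - 1, ∑ l, h l * g' l ^ Fintype.card F ^ s = 0 := by
    intro s hs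
    have := congrFun hh ⟨s, hs⟩
    simpa [Matrix.mulVec, dotProduct, moore, mul_comm] using this
  refine ⟨h, vecRank_of_linearIndependent F (linearIndependent_of_relations F ?_), ?_⟩
  · have := finrank_relations_add_lt F hg' hh0 horth
    omega
  · ext j i
    rw [Matrix.mul_apply, Matrix.zero_apply]
    have h1 := congrArg (· ^ Fintype.card F ^ (j : ℕ)) (horth (n - k - 1 + i - j) (by omega))
    simp only [sum_pow_card, zero_pow (pow_ne_zero _ Fintype.card_ne_zero), mul_pow] at h1
    rw [← h1]
    refine Finset.sum_congr rfl fun l _ => ?_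
    rw [Matrix.transpose_apply, ← pow_mul, ← pow_add,
      show n - k - 1 + i - j + j = n - k - 1 + i by omega, pow_add, pow_mul,
      invFrob_pow_card]
    rfl

theorem syndrome_eq_zero {ℓ n k : ℕ} {g h : Fin n → K} (hh : IsParityCheckVector F g k h)
    {C : Matrix (Fin ℓ) (Fin n) K} (hC : C ∈ interleaved ℓ (gabidulin F g k)) (i : Fin ℓ) (j : ℕ)
    (hj : j < n - k) : syndrome F h C i j = 0 := by
  obtain ⟨f, hf⟩ := exists_coeff_of_mem_gabidulin F (hC i)
  simp only [syndrome, hf, eval_linPoly, Finset.sum_mul]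
  rw [Finset.sum_comm]
  refine Finset.sum_eq_zero fun s _ => ?_
  have := congrFun (congrFun hh.2 ⟨j, hj⟩) s
  rw [Matrix.mul_apply] at this
  simp only [mul_assoc, ← Finset.mul_sum]
  refine mul_eq_zero_of_right _ (Eq.trans ?_ this)
  exact Finset.sum_congr rfl fun l _ => mul_comm _ _

/-- Each register equation is a combination of the values Γ(d_u) whose coefficients form an inverse
Frobenius twist of A. Left invertibility cancels A, and the single index r = L suffices because all
ℓ sequences are used. -/
theorem generates_iff {ℓ n t N L : ℕ} {h : Fin n → K} {R : Matrix (Fin ℓ) (Fin n) K}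
    {d : Fin t → K} {A : Matrix (Fin ℓ) (Fin t) K} {A' : Matrix (Fin t) (Fin ℓ) K}
    (hA : A' * A = 1)
    (hs : ∀ i, ∀ j < N, syndrome F h R i j = ∑ u, A i u * d u ^ Fintype.card F ^ j)
    (hL : L < N) (Γ : Fin (L + 1) → K) :
    Generates F N (modSyndrome F h N R) L Γ ↔
      Γ 0 = 1 ∧ ∀ u, ∑ j, Γ j * d u ^ Fintype.card F ^ (j : ℕ) = 0 := by
  have hmod : ∀ i, ∀ r < N, modSyndrome F h N R i r =
      ∑ u, invFrob F (N - 1 - r) (A i u) * d u := by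
    intro i r hr
    rw [modSyndrome, hs i _ (by omega)]
    change invFrob F (N - 1 - r) _ = _
    rw [map_sum]
    refine Finset.sum_congr rfl fun u _ => ?_
    rw [map_mul, map_pow, invFrob_pow_card]
  have hsum : ∀ i, ∀ r, L ≤ r → r < N →
      ∑ j : Fin (L + 1), Γ j * modSyndrome F h N R i (r - j) ^ Fintype.card F ^ (j : ℕ) =
        ∑ u, invFrob F (N - 1 - r) (A i u) * ∑ j, Γ j * d u ^ Fintype.card F ^ (j : ℕ) := by
    intro i r hLr hr
    simp only [Finset.mul_sum]
    rw [Finset.sum_comm]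
    refine Finset.sum_congr rfl fun j _ => ?_
    rw [hmod i _ (by omega), sum_pow_card, Finset.mul_sum]
    refine Finset.sum_congr rfl fun u _ => ?_
    rw [mul_pow, show N - 1 - (r - j) = N - 1 - r + j by omega, invFrob_add_pow_card]
    ring
  constructor
  · rintro ⟨h0, h1⟩
    refine ⟨h0, fun u => ?_⟩
    refine congrFun (eq_zero_of_sum_map_mul_eq_zero hA
      (invFrob F (N - 1 - L)).toRingEquiv.toRingHom
      (y := fun u => ∑ j, Γ j * d u ^ Fintype.card F ^ (j : ℕ)) fun i => ?_) u
    refine Eq.trans ?_ ((hsum i L le_rfl hL).symm.trans (h1 i L le_rfl hL))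
    rfl
  · rintro ⟨h0, h1⟩
    refine ⟨h0, fun i r hLr hr => ?_⟩
    rw [hsum i r hLr hr]
    simp [h1]

/-- Once Γ_0 = 1 is fixed, the other t coefficients solve a nonsingular Moore system at the points
d_u^q. -/
theorem existsUnique_span_polynomial {t : ℕ} {d : Fin t → K} (hd : LinearIndependent F d) :
    ∃ Γ : Fin (t + 1) → K, ∀ Γ' : Fin (t + 1) → K,
      (Γ' 0 = 1 ∧ ∀ u, ∑ j, Γ' j * d u ^ Fintype.card F ^ (j : ℕ) = 0) ↔ Γ' = Γ := by
  have hd1 : LinearIndependent F fun u => d u ^ Fintype.card F := by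
    have := hd.map' (FiniteField.frobeniusAlgHom F K).toLinearMap
      (LinearMap.ker_eq_bot.2 (FiniteField.frobeniusAlgHom F K).injective)
    exact this
  obtain ⟨c, hc⟩ := exists_moore_interpolation F hd1 (-d)
  have hsum : ∀ Γ' : Fin (t + 1) → K, ∀ u, ∑ j, Γ' j * d u ^ Fintype.card F ^ (j : ℕ) =
      Γ' 0 * d u + ∑ j : Fin t, Γ' j.succ * (d u ^ Fintype.card F) ^ Fintype.card F ^ (j : ℕ) := by
    intro Γ' u
    rw [Fin.sum_univ_succ]
    simp [pow_succ', pow_mul]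
  refine ⟨Fin.cons 1 c, fun Γ' => ⟨?_, ?_⟩⟩
  · rintro ⟨h0, h1⟩
    have htail : (fun j : Fin t => Γ' j.succ - c j) = 0 := by
      refine linPoly_coeff_eq_zero F hd1 (by simp) _ fun u => ?_
      have h2 := h1 u
      rw [hsum, h0, one_mul] at h2
      simp only [sub_mul, Finset.sum_sub_distrib, hc, Pi.neg_apply, sub_neg_eq_add]
      rw [add_comm, h2]
    ext j
    refine Fin.cases h0 (fun j => ?_) j
    simpa [sub_eq_zero] using congrFun htail j
  · rintro rfl
    refine ⟨rfl, fun u => ?_⟩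
    rw [hsum]
    simp only [Fin.cons_zero, Fin.cons_succ, hc, Pi.neg_apply, one_mul, add_neg_cancel]

/-- A root outside the span would give t + 1 independent roots, too many for t + 1 coefficients that
are not all zero. -/
theorem mem_span_iff_isRoot {t : ℕ} {d : Fin t → K} (hd : LinearIndependent F d)
    {Γ : Fin (t + 1) → K} (hΓ : Γ 0 = 1)
    (hroot : ∀ u, ∑ j, Γ j * d u ^ Fintype.card F ^ (j : ℕ) = 0) (x : K) :
    x ∈ Submodule.span F (Set.range d) ↔ (linPoly F Γ).IsRoot x := by
  constructor
  · intro hx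
    have : Submodule.span F (Set.range d) ≤ LinearMap.ker (linEval F Γ) := by
      rw [Submodule.span_le]
      rintro _ ⟨u, rfl⟩
      simpa [linEval_apply, eval_linPoly] using hroot u
    have := this hx
    rwa [LinearMap.mem_ker, linEval_apply] at this
  · intro hx
    by_contra hmem
    have hli : LinearIndependent F (Fin.cons x d : Fin (t + 1) → K) :=
      linearIndependent_finCons.2 ⟨hd, hmem⟩
    have h0 : Γ = 0 := by
      refine linPoly_coeff_eq_zero F hli (by simp) Γ fun u => ?_
      refine Fin.cases ?_ (fun u => ?_) u
      · simpa [eval_linPoly] using hx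
      · simpa using hroot u
    rw [h0] at hΓ
    exact zero_ne_one hΓ

theorem sidorenkoBossert_eq {ℓ n k t : ℕ} {g : Fin n → K} (hg : LinearIndependent F g)
    {T : Matrix (Fin n) (Fin n) F} (hT : IsUnit T.det) (htn : t ≤ n)
    {A : Matrix (Fin ℓ) (Fin t) K} {A' : Matrix (Fin t) (Fin ℓ) K} (hA : A' * A = 1)
    {C : Matrix (Fin ℓ) (Fin n) K} (hC : C ∈ interleaved ℓ (gabidulin F g k))
    (ht : t + 1 ≤ n - k) (horder : t ≤ ℓ) :
    sidorenkoBossert F g k (C + A * (T.submatrix (Fin.castLE htn) id).map (algebraMap F K)) =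
      {some C} := by
  set E := A * (T.submatrix (Fin.castLE htn) id).map (algebraMap F K) with hE
  have htr := le_radius (ℓ := ℓ) horder ht
  refine attempt_eq_singleton (exists_isParityCheckVector F hg (by omega)) fun h hh => ?_
  have hli : LinearIndependent F h := linearIndependent_of_vecRank F hh.1
  let d : Fin t → K := fun u => ∑ l, T (Fin.castLE htn u) l • h l
  have hd : LinearIndependent F d := by
    have := linearIndependent_mul F hli (S := T.transpose) (by rwa [Matrix.det_transpose])
    exact this.comp (Fin.castLE htn) (Fin.castLE_injective htn)
  have hs : ∀ i, ∀ j < n - k,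
      syndrome F h (C + E) i j = ∑ u, A i u * d u ^ Fintype.card F ^ j := by
    intro i j hj
    have h0 := syndrome_eq_zero F hh hC i j hj
    simp only [syndrome] at h0 ⊢
    simp only [Matrix.add_apply, add_mul, Finset.sum_add_distrib, h0, zero_add, hE,
      factorization_apply, d, sum_smul_pow_card, Finset.sum_mul, Finset.mul_sum, smul_mul_assoc,
      mul_smul_comm]
    rw [Finset.sum_comm]
  obtain ⟨Γ₀, hΓ₀⟩ := existsUnique_span_polynomial F hd
  have hleast : IsLeast
      {L : ℕ | ∃ Γ, Generates F (n - k) (modSyndrome F h (n - k) (C + E)) L Γ} t := by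
    refine ⟨⟨Γ₀, (generates_iff F hA hs ht Γ₀).2 ((hΓ₀ Γ₀).2 rfl)⟩, ?_⟩
    rintro L ⟨Γ, hΓ⟩
    by_contra! hL
    rw [generates_iff F hA hs (by omega)] at hΓ
    have h0 : Γ = 0 := linPoly_coeff_eq_zero F hd (by simpa using hL) Γ hΓ.2
    exact zero_ne_one ((congrFun h0 0).symm.trans hΓ.1)
  refine attempt_eq_singleton ⟨t, htr, hleast⟩ fun L hL => ?_
  obtain rfl : L = t := hL.2.unique hleast
  have hgen : ∀ Γ', Generates F (n - k) (modSyndrome F h (n - k) (C + E)) L Γ' ↔ Γ' = Γ₀ :=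
    fun Γ' => (generates_iff F hA hs ht Γ').trans (hΓ₀ Γ')
  refine attempt_eq_singleton ⟨Γ₀, hgen⟩ fun Γ hΓ => ?_
  obtain rfl : Γ = Γ₀ := (hgen Γ).1 ((hΓ Γ).2 rfl)
  obtain ⟨hΓ0, hΓd⟩ := (hΓ₀ Γ).2 rfl
  have hspan := mem_span_iff_isRoot F hd hΓ0 hΓd
  refine attempt_eq_singleton ⟨d, hd, hspan⟩ fun d' hd' => ?_
  have hdh : ∀ u, ∃ b : Fin n → F, ∑ l, b l • h l = d' u := by
    intro u
    rw [← Submodule.mem_span_range_iff_exists_fun]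
    have h1 : d' u ∈ Submodule.span F (Set.range d) :=
      (hspan _).2 ((hd'.2 _).1 (Submodule.subset_span ⟨u, rfl⟩))
    refine Submodule.span_le.2 ?_ h1
    rintro _ ⟨v, rfl⟩
    exact sum_mem fun l _ => Submodule.smul_mem _ _ (Submodule.subset_span ⟨l, rfl⟩)
  have hdd : ∀ v, ∃ b : Fin L → F, ∑ u, b u • d' u = d v := by
    intro v
    rw [← Submodule.mem_span_range_iff_exists_fun]
    exact (hd'.2 _).2 ((hspan _).1 (Submodule.subset_span ⟨v, rfl⟩))
  choose B₀ hB₀ using hdh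
  choose M hM using hdd
  refine attempt_eq_singleton ⟨B₀, fun u => (hB₀ u).symm⟩ fun B hB => ?_
  -- Since d = M d', the coefficient matrix relative to the chosen basis d' is A M.
  let A₁ : Matrix (Fin ℓ) (Fin L) K := fun i u => ∑ v, M v u • A i v
  have hA₁ : ∀ i, ∀ j < n - k,
      ∑ u, A₁ i u * d' u ^ Fintype.card F ^ j = syndrome F h (C + E) i j := by
    intro i j hj
    rw [hs i j hj]
    simp only [A₁, ← hM, sum_smul_pow_card, Finset.sum_mul, Finset.mul_sum, smul_mul_assoc,
      mul_smul_comm]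
    rw [Finset.sum_comm]
  refine attempt_eq_singleton ⟨A₁, hA₁⟩ fun A₂ hA₂ => ?_
  have hAeq : A₂ = A₁ := by
    ext i u
    have := eq_zero_of_moore_mulVec F hd'.1 (N := n - k) (by simp; omega) (A₂ i - A₁ i)
      fun s hs' => by
        simp only [Pi.sub_apply, sub_mul, Finset.sum_sub_distrib]
        rw [hA₂ i s hs', hA₁ i s hs', sub_self]
    exact sub_eq_zero.1 (congrFun this u)
  -- Both sides express d_v through the independent entries of h, so A M B is the original error.
  have hMB : ∀ v l, ∑ u, M v u * B u l = T (Fin.castLE htn v) l := by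
    intro v l
    refine congrFun (a := l) (hli.fintypeLinearCombination_injective
      (a₁ := fun l => ∑ u, M v u * B u l) (a₂ := T (Fin.castLE htn v)) ?_)
    simp only [Fintype.linearCombination_apply, Finset.sum_smul, mul_smul]
    rw [Finset.sum_comm]
    simp only [← Finset.smul_sum, ← hB _, hM]
    rfl
  have hprod : A₂ * B.map (algebraMap F K) = E := by
    ext i l
    rw [hAeq, hE, factorization_apply, Matrix.mul_apply]
    simp only [A₁, ← hMB, Finset.sum_mul, Finset.sum_smul, mul_smul]
    rw [Finset.sum_comm]
    refine Finset.sum_congr rfl fun v _ => Finset.sum_congr rfl fun u _ => ?_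
    rw [Matrix.map_apply, smul_mul_assoc, Algebra.smul_def (B u l), mul_comm (A i v)]
  rw [hprod, add_sub_cancel_right]

end RankMetric

/-! ### The Loidreau–Overbeck decoder -/

namespace RankMetric

variable (F : Type*) {K : Type*} [Field F] [Fintype F] [Field K] [Algebra F K]

/-- The rows `g, g^[1], …, g^[s-1]`, followed by the first `t` rows of `T`. -/
noncomputable def mooreRowSpace {n t : ℕ} (s : ℕ) (g : Fin n → K) (T : Matrix (Fin n) (Fin n) F)
    (htn : t ≤ n) : Fin s ⊕ Fin t → Fin n → K :=
  Sum.elim (moore F s g) fun u l => algebraMap F K (T (Fin.castLE htn u) l)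

/-- Frobenius fixes B, so R^[s] = C^[s] + A^[s] B. The Moore rows in C^[s] have index at most s + k
- 1 ≤ n - τ - 2. -/
theorem span_loMatrix_le {ℓ n k t τ : ℕ} {g : Fin n → K} {T : Matrix (Fin n) (Fin n) F}
    (htn : t ≤ n) (A : Matrix (Fin ℓ) (Fin t) K) {C : Matrix (Fin ℓ) (Fin n) K}
    (hC : C ∈ interleaved ℓ (gabidulin F g k)) :
    Submodule.span K (Set.range (loMatrix F g k τ
      (C + A * (T.submatrix (Fin.castLE htn) id).map (algebraMap F K))).row) ≤
    Submodule.span K (Set.range (mooreRowSpace F (n - τ - 1) g T htn)) := by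
  rw [Submodule.span_le]
  rintro _ ⟨i | ⟨s, i⟩, rfl⟩
  · exact Submodule.subset_span ⟨Sum.inl i, rfl⟩
  · obtain ⟨f, hf⟩ := exists_coeff_of_mem_gabidulin F (hC i)
    have hrow : (loMatrix F g k τ
        (C + A * (T.submatrix (Fin.castLE htn) id).map (algebraMap F K))).row (Sum.inr (s, i)) =
        ∑ j : Fin k, f j ^ Fintype.card F ^ (s : ℕ) •
            mooreRowSpace F (n - τ - 1) g T htn (Sum.inl ⟨j + s, by omega⟩) +
          ∑ u, A i u ^ Fintype.card F ^ (s : ℕ) •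
            mooreRowSpace F (n - τ - 1) g T htn (Sum.inr u) := by
      ext l
      change (C + _) i l ^ Fintype.card F ^ (s : ℕ) = _
      rw [Matrix.add_apply, hf, eval_linPoly, factorization_apply, ← frob_apply, map_add,
        frob_apply, frob_apply, sum_pow_card, sum_smul_pow_card]
      simp only [Pi.add_apply, Finset.sum_apply, mooreRowSpace, moore, mul_pow, ← pow_mul,
        ← pow_add, Algebra.smul_def]
      congr 1
      exact Finset.sum_congr rfl fun u _ => mul_comm _ _
    rw [hrow]
    refine add_mem (sum_mem fun j _ => ?_) (sum_mem fun u _ => ?_) <;>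
      exact Submodule.smul_mem _ _ (Submodule.subset_span ⟨_, rfl⟩)

/-- The unpowered rows of R suffice: B = A' (R - C), and C is spanned by Moore rows already present
because k ≤ n - τ - 1. -/
theorem le_span_loMatrix {ℓ n k t τ : ℕ} {g : Fin n → K} {T : Matrix (Fin n) (Fin n) F}
    (htn : t ≤ n) {A : Matrix (Fin ℓ) (Fin t) K} {A' : Matrix (Fin t) (Fin ℓ) K}
    (hA : A' * A = 1) {C : Matrix (Fin ℓ) (Fin n) K}
    (hC : C ∈ interleaved ℓ (gabidulin F g k)) (hτ : τ < n - k) :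
    Submodule.span K (Set.range (mooreRowSpace F (n - τ - 1) g T htn)) ≤
    Submodule.span K (Set.range (loMatrix F g k τ
      (C + A * (T.submatrix (Fin.castLE htn) id).map (algebraMap F K))).row) := by
  set E := A * (T.submatrix (Fin.castLE htn) id).map (algebraMap F K) with hE
  rw [Submodule.span_le]
  rintro _ ⟨i | u, rfl⟩
  · exact Submodule.subset_span ⟨Sum.inl i, rfl⟩
  have hCmem : ∀ i, C i ∈ Submodule.span K (Set.range (loMatrix F g k τ (C + E)).row) := by
    intro i
    refine Submodule.span_le.2 ?_ (hC i)
    rintro _ ⟨j, rfl⟩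
    exact Submodule.subset_span ⟨Sum.inl ⟨j, by omega⟩, rfl⟩
  have hRmem : ∀ i, (C + E) i ∈ Submodule.span K (Set.range (loMatrix F g k τ (C + E)).row) := by
    intro i
    refine Submodule.subset_span ⟨Sum.inr (⟨0, by omega⟩, i), ?_⟩
    ext l
    change (C + E) i l ^ Fintype.card F ^ 0 = _
    simp
  have hrow : mooreRowSpace F (n - τ - 1) g T htn (Sum.inr u) =
      ∑ i, A' u i • ((C + E) i - C i) := by
    have h1 : A' * E = (T.submatrix (Fin.castLE htn) id).map (algebraMap F K) := by
      rw [hE, ← Matrix.mul_assoc, hA, Matrix.one_mul]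
    ext l
    have h2 := congrFun (congrFun h1 u) l
    rw [Matrix.mul_apply] at h2
    refine h2.symm.trans ?_
    simp
  rw [hrow]
  exact sum_mem fun i _ => Submodule.smul_mem _ _ (sub_mem (hRmem i) (hCmem i))

variable [FiniteDimensional F K]

/-- Right multiplication by T⁻¹ turns the rows of B into unit vectors and keeps the Moore form. The
last n - t columns see only the Moore part, which is therefore zero; the first t columns then give
the rest. -/
theorem linearIndependent_mooreRowSpace {n s t : ℕ} {g : Fin n → K} (hg : LinearIndependent F g)
    {T : Matrix (Fin n) (Fin n) F} (hT : IsUnit T.det) (htn : t ≤ n) (hs : s ≤ n - t) :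
    LinearIndependent K (mooreRowSpace F s g T htn) := by
  rw [Fintype.linearIndependent_iff]
  intro a ha
  rw [Fintype.sum_sum_type] at ha
  have hcol : ∀ l, ∑ i : Fin s, a (Sum.inl i) * g l ^ Fintype.card F ^ (i : ℕ) +
      ∑ u : Fin t, T (Fin.castLE htn u) l • a (Sum.inr u) = 0 := by
    intro l
    have := congrFun ha l
    simp only [Pi.add_apply, Finset.sum_apply, Pi.smul_apply, smul_eq_mul, Pi.zero_apply] at this
    refine (congrArg₂ (· + ·) rfl (Finset.sum_congr rfl fun u _ => ?_)).trans this
    rw [Algebra.smul_def, mul_comm]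
    rfl
  have hcomb : ∀ j, ∑ i : Fin s, a (Sum.inl i) *
        (∑ l, T⁻¹ l j • g l) ^ Fintype.card F ^ (i : ℕ) +
      ∑ u : Fin t, (1 : Matrix (Fin n) (Fin n) F) (Fin.castLE htn u) j • a (Sum.inr u) = 0 := by
    intro j
    have h : ∑ l, T⁻¹ l j • (∑ i : Fin s, a (Sum.inl i) * g l ^ Fintype.card F ^ (i : ℕ) +
      ∑ u : Fin t, T (Fin.castLE htn u) l • a (Sum.inr u)) = 0 := by
      simp only [hcol, smul_zero, Finset.sum_const_zero]
    rw [← h]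
    simp only [smul_add, Finset.sum_add_distrib, sum_smul_pow_card, Finset.mul_sum,
      Finset.smul_sum, mul_smul_comm, smul_smul, ← Matrix.mul_nonsing_inv _ hT, Matrix.mul_apply,
      Finset.sum_smul]
    congr 1
    · rw [Finset.sum_comm]
    · rw [Finset.sum_comm]
      simp only [mul_comm]
  have hinl : (fun i : Fin s => a (Sum.inl i)) = 0 := by
    let S := {j : Fin n // t ≤ (j : ℕ)}
    refine linPoly_coeff_eq_zero F
      ((linearIndependent_mul F hg (Matrix.isUnit_nonsing_inv_det _ hT)).comp
        (Subtype.val : S → Fin n) Subtype.val_injective)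
      (hs.trans_eq (card_fin_ge n t).symm) _ fun j => ?_
    have h := hcomb j
    rw [Finset.sum_eq_zero (s := Finset.univ) (f := fun u : Fin t =>
      (1 : Matrix (Fin n) (Fin n) F) (Fin.castLE htn u) j • a (Sum.inr u)), add_zero] at h
    · exact h
    · intro u _
      rw [Matrix.one_apply_ne, zero_smul]
      intro h0
      have h1 := j.2
      rw [← h0, Fin.val_castLE] at h1
      omega
  have hinl' : ∀ i : Fin s, a (Sum.inl i) = 0 := congrFun hinl
  rintro (i | u)
  · exact hinl' i
  · have h := hcomb (Fin.castLE htn u)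
    simp only [hinl', zero_mul, Finset.sum_const_zero, zero_add] at h
    rw [Finset.sum_eq_single u] at h
    · simpa using h
    · intro v _ hv
      rw [Matrix.one_apply_ne fun h0 => hv (Fin.castLE_injective htn h0), zero_smul]
    · simp

/-- By dimension, the first t rows of T span all relations, and T⁻¹ sends them to the first t unit
vectors. -/
theorem vecMul_inv_eq_zero_of_mem_relations {n t : ℕ} {h : Fin n → K}
    {T : Matrix (Fin n) (Fin n) F} (hT : IsUnit T.det) (htn : t ≤ n)
    (hTh : ∀ u, T (Fin.castLE htn u) ∈ relations F h)
    (hrank : Module.finrank F (relations F h) ≤ t) {v : Fin n → F} (hv : v ∈ relations F h)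
    (j : Fin n) (hj : t ≤ (j : ℕ)) : Matrix.vecMul v T⁻¹ j = 0 := by
  have hli : LinearIndependent F fun u => T (Fin.castLE htn u) :=
    (Matrix.linearIndependent_rows_of_isUnit ((Matrix.isUnit_iff_isUnit_det _).2 hT)).comp
      (Fin.castLE htn) (Fin.castLE_injective htn)
  have hle : Submodule.span F (Set.range fun u => T (Fin.castLE htn u)) ≤ relations F h :=
    Submodule.span_le.2 (by rintro _ ⟨u, rfl⟩; exact hTh u)
  have heq := Submodule.eq_of_le_of_finrank_le hle (by
    rw [finrank_span_eq_card hli]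
    simpa using hrank)
  rw [← heq, Submodule.mem_span_range_iff_exists_fun] at hv
  obtain ⟨c, rfl⟩ := hv
  rw [Matrix.sum_vecMul, Finset.sum_apply]
  refine Finset.sum_eq_zero fun u _ => ?_
  rw [Matrix.smul_vecMul, Pi.smul_apply]
  have : Matrix.vecMul (T (Fin.castLE htn u)) T⁻¹ = (T * T⁻¹) (Fin.castLE htn u) := by
    rw [Matrix.mul_apply_eq_vecMul]
  rw [this, Matrix.mul_nonsing_inv _ hT, Matrix.one_apply_ne, smul_zero]
  intro h0
  rw [← h0, Fin.val_castLE] at hj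
  omega

theorem loidreauOverbeck_eq {ℓ n k t : ℕ} {g : Fin n → K} (hg : LinearIndependent F g)
    {T : Matrix (Fin n) (Fin n) F} (hT : IsUnit T.det) (htn : t ≤ n)
    {A : Matrix (Fin ℓ) (Fin t) K} {A' : Matrix (Fin t) (Fin ℓ) K} (hA : A' * A = 1)
    {C : Matrix (Fin ℓ) (Fin n) K} (hC : C ∈ interleaved ℓ (gabidulin F g k))
    (ht : t + 1 ≤ n - k) (horder : t ≤ ℓ) :
    loidreauOverbeck F g k (C + A * (T.submatrix (Fin.castLE htn) id).map (algebraMap F K)) =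
      {some C} := by
  set E := A * (T.submatrix (Fin.castLE htn) id).map (algebraMap F K) with hE
  have htr := le_radius (ℓ := ℓ) horder ht
  have hrad : radius ℓ n k < n - k := radius_lt (by omega)
  have hspan := le_antisymm (span_loMatrix_le F htn A hC (τ := t) (T := T))
    (le_span_loMatrix F htn hA hC (by omega) (T := T))
  rw [← hE] at hspan
  have hrank : (loMatrix F g k t (C + E)).rank = n - 1 := by
    rw [Matrix.rank_eq_finrank_span_row, hspan,
      finrank_span_eq_card (linearIndependent_mooreRowSpace F hg hT htn (by omega))]
    simp
    omega
  have hgreatest : IsGreatest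
      {τ : ℕ | τ ≤ radius ℓ n k ∧ (loMatrix F g k τ (C + E)).rank = n - 1} t := by
    refine ⟨⟨htr, hrank⟩, ?_⟩
    rintro τ ⟨hτ, hτr⟩
    -- For τ > t, the row space is spanned by (n - τ - 1) + t < n - 1 vectors.
    by_contra! hlt
    have h1 := Submodule.finrank_mono (span_loMatrix_le F htn A hC (τ := τ) (T := T))
    rw [← hE, ← Matrix.rank_eq_finrank_span_row, hτr] at h1
    have h2 := finrank_range_le_card (R := K) (mooreRowSpace F (n - τ - 1) g T htn)
    rw [Set.finrank, Fintype.card_sum, Fintype.card_fin, Fintype.card_fin] at h2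
    omega
  refine attempt_eq_singleton ⟨t, hgreatest⟩ fun τ hτ => ?_
  obtain rfl : τ = t := IsGreatest.unique hτ hgreatest
  have hker : LinearMap.ker (loMatrix F g k τ (C + E)).mulVecLin ≠ ⊥ := by
    intro h0
    have h1 := (loMatrix F g k τ (C + E)).mulVecLin.finrank_range_add_finrank_ker
    rw [h0, finrank_bot, Module.finrank_fin_fun] at h1
    change (loMatrix F g k τ (C + E)).rank + 0 = n at h1
    omega
  obtain ⟨h₀, hh₀, hh₀'⟩ := Submodule.exists_mem_ne_zero_of_ne_bot hker
  refine attempt_eq_singleton ⟨h₀, hh₀', hh₀⟩ fun h hh => ?_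
  have horth : ∀ p, mooreRowSpace F (n - τ - 1) g T htn p ⬝ᵥ h = 0 := by
    intro p
    have hmem : mooreRowSpace F (n - τ - 1) g T htn p ∈
        Submodule.span K (Set.range (loMatrix F g k τ (C + E)).row) := by
      rw [hspan]
      exact Submodule.subset_span ⟨p, rfl⟩
    refine Submodule.span_induction (p := fun v _ => v ⬝ᵥ h = 0) ?_ ?_ ?_ ?_ hmem
    · rintro _ ⟨i, rfl⟩
      exact congrFun hh.2 i
    · exact zero_dotProduct h
    · intro v w _ _ hv hw
      rw [add_dotProduct, hv, hw, add_zero]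
    · intro a v _ hv
      rw [smul_dotProduct, hv, smul_zero]
  have hlow : Module.finrank F (relations F h) ≤ τ := by
    have := finrank_relations_add_lt F hg hh.1 (N := n - τ - 1) fun s hs => by
      rw [← horth (Sum.inl ⟨s, hs⟩)]
      exact Finset.sum_congr rfl fun l _ => mul_comm _ _
    omega
  have hmulVec : ∀ (T' : Matrix (Fin n) (Fin n) F) j,
      (T'.map (algebraMap F K)).mulVec h j = 0 ↔ T' j ∈ relations F h := by
    intro T' j
    rw [mem_relations]
    simp only [Algebra.smul_def]
    rfl
  have hTrel : ∀ u, T (Fin.castLE htn u) ∈ relations F h := by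
    intro u
    rw [mem_relations, ← horth (Sum.inr u)]
    simp only [Algebra.smul_def]
    rfl
  refine attempt_eq_singleton ⟨T, hT, fun j hj => (hmulVec T j).2 (hTrel ⟨j, hj⟩)⟩ fun T' hT' => ?_
  -- `T'` need not be `T`, but its first τ rows span the relations of h, among which are the rows of
  -- B.
  have hE' : ∀ i, ∀ j : Fin n, τ ≤ (j : ℕ) → ∑ l, T'⁻¹ l j • E i l = 0 := by
    intro i j hj
    simp only [hE, factorization_apply, Finset.smul_sum, smul_smul]
    rw [Finset.sum_comm]
    refine Finset.sum_eq_zero fun u _ => ?_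
    have := vecMul_inv_eq_zero_of_mem_relations F hT'.1 htn
      (fun u => (hmulVec T' _).1 (hT'.2 _ u.2)) hlow (hTrel u) j hj
    rw [← Finset.sum_smul]
    simp only [Matrix.vecMul, dotProduct, mul_comm] at this ⊢
    rw [this, zero_smul]
  have hinv : (T'.map (algebraMap F K))⁻¹ = T'⁻¹.map (algebraMap F K) := by
    refine Matrix.inv_eq_left_inv ?_
    rw [← Matrix.map_mul, Matrix.nonsing_inv_mul _ hT'.1]
    simp
  have hmul : ∀ (D : Matrix (Fin ℓ) (Fin n) K) i j,
      (D * (T'.map (algebraMap F K))⁻¹) i j = ∑ l, T'⁻¹ l j • D i l := by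
    intro D i j
    rw [hinv, Matrix.mul_apply]
    refine Finset.sum_congr rfl fun l _ => ?_
    rw [Matrix.map_apply, Algebra.smul_def, mul_comm]
  refine attempt_eq_singleton ⟨C, hC, fun i j hj => ?_⟩ fun C' hC' => ?_
  · rw [hmul, add_sub_cancel_left]
    exact hE' i j hj
  · have hCC : C' = C := by
      ext i l
      obtain ⟨f, hf⟩ := exists_coeff_of_mem_gabidulin F (sub_mem (hC i) (hC'.1 i))
      -- The difference of the two codewords vanishes at n - τ ≥ k independent points of g T'⁻¹.
      have hf0 : f = 0 := by
        let S := {j : Fin n // τ ≤ (j : ℕ)}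
        refine linPoly_coeff_eq_zero F
          ((linearIndependent_mul F hg (Matrix.isUnit_nonsing_inv_det _ hT'.1)).comp
            (Subtype.val : S → Fin n) Subtype.val_injective)
          ((show k ≤ n - τ by omega).trans_eq (card_fin_ge n τ).symm) _ fun j => ?_
        have h1 := hC'.2 i j j.2
        rw [hmul] at h1
        have h2 := hE' i j j.2
        rw [← eval_linPoly, ← linEval_apply, Function.comp_apply, map_sum]
        simp only [map_smul]
        simp only [linEval_apply, ← hf]
        simp only [Matrix.sub_apply, Matrix.add_apply, smul_sub, smul_add, Finset.sum_sub_distrib,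
          Finset.sum_add_distrib, h2, add_zero] at h1
        simpa only [Pi.sub_apply, smul_sub, Finset.sum_sub_distrib] using h1
      have h3 := hf l
      rw [hf0, eval_linPoly] at h3
      simp only [Pi.zero_apply, zero_mul, Finset.sum_const_zero, Pi.sub_apply] at h3
      exact (sub_eq_zero.1 h3).symm
    rw [hCC]

end RankMetric

theorem theorem4 {F K : Type*} [Field F] [Fintype F] [Field K] [Algebra F K]
    [FiniteDimensional F K] (ℓ n k t : ℕ)
    (g : Fin n → K) (hg : RankMetric.vecRank F g = n)
    (C E : Matrix (Fin ℓ) (Fin n) K)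
    (hC : C ∈ RankMetric.interleaved ℓ (RankMetric.gabidulin F g k))
    (ht : t + 2 ≤ n - k + 1)
    (hsmall : RankMetric.smallRank F E = t)
    (horder : t ≤ ℓ)
    (hfull : E.rank = t) :
    RankMetric.loidreauOverbeck F g k (C + E) = {some C} ∧
      RankMetric.sidorenkoBossert F g k (C + E) = {some C} ∧
      RankMetric.wachterZehZeh F g k (C + E) = {some C} := by
  have hli := RankMetric.linearIndependent_of_vecRank F hg
  obtain ⟨T, htn, A, A', hT, hA, rfl⟩ := RankMetric.exists_factorization F E hsmall hfull
  -- As subtraction is truncated, this also forces k < n.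
  have ht' : t + 1 ≤ n - k := by omega
  exact ⟨RankMetric.loidreauOverbeck_eq F hli hT htn hA hC ht' horder,
    RankMetric.sidorenkoBossert_eq F hli hT htn hA hC ht' horder,
    RankMetric.wachterZehZeh_eq F hli hT htn hA hC ht' horder⟩
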